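/- For an integer $n\ge 1$, let $\mathcal N_n$ denote the set of Newman polynomials of degree $n$, that is, the polynomials $f(z)=a_0+a_1z+\dots+a_nz^n$ with $a_0=a_n=1$ and $a_j\in\{0,1\}$ for all $0\le j\le n$. For $f\in\mathcal N_n$ let $N(f)$ be the number of complex zeros of $f$ in the open unit disk $|z|<1$, counted with multiplicity. A pair $(k,n)$ of integers with $1\le k\le n-1$ is called Newman-admissible if there exists $f\in\mathcal N_n$ that does not vanish on the unit circle $|z|=1$ and satisfies $N(f)=k$. **Theorem.** Let $n$ be an integer such that either 1. $3\le n\le 20$, or 2. $n>20$ and $n\not\equiv 1,7,15,21,25,27\pmod{30}$. Then both pairs $(2,n)$ and $(n-2,n)$ are Newman-admissible. -/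

import Mathlib

open Polynomial

/-- Newman polynomials of degree `n`: integer polynomials `a₀ + a₁ z + ⋯ + aₙ zⁿ` with
`a₀ = aₙ = 1` and all coefficients in `{0, 1}`. -/
def newmanPolys (n : ℕ) : Set ℤ[X] :=
  {f | f.natDegree = n ∧ f.coeff 0 = 1 ∧ f.coeff n = 1 ∧ ∀ j, f.coeff j = 0 ∨ f.coeff j = 1}

/-- The number of complex zeros of `f` in the open unit disk, counted with multiplicity. -/
noncomputable def zerosInDisk (f : ℤ[X]) : ℕ :=
  Multiset.card ((f.map (Int.castRingHom ℂ)).roots.filter fun z => ‖z‖ < 1)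

/-- The pair `(k, n)` is Newman-admissible: `1 ≤ k ≤ n - 1`, and some Newman polynomial of
degree `n` without zeros on the unit circle has exactly `k` zeros in the open unit disk. -/
def NewmanAdmissible (k n : ℕ) : Prop :=
  (1 ≤ k ∧ k < n) ∧
    ∃ f ∈ newmanPolys n, (∀ z : ℂ, ‖z‖ = 1 → aeval z f ≠ 0) ∧ zerosInDisk f = k

/-! Reversing a polynomial replaces its zeros by their inverses, so a Newman polynomial of degree
`n` with two zeros in the disk and none on the circle settles both pairs. Three periodic families
(degrees 2 mod 3, and 3 and 4 mod 5) and one family of even degree supply such polynomials; degrees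
7 and 15 are treated separately. Within a family, the disk count does not depend on the length: by
`one_add_mul_geom_sum_ne_zero`, the segment from the shortest member to any other stays zero-free on
the circle, and `diskCount_eq_of_homotopy` applies. The shortest members, and degrees 7 and 15, are
computed by a Schur–Cohn recursion justified by Rouché's theorem. -/

/-- The number of zeros of a complex polynomial in the open unit disk, with multiplicity. -/
noncomputable def diskCount (p : ℂ[X]) : ℕ :=
  Multiset.card (p.roots.filter fun z => ‖z‖ < 1)

theorem zerosInDisk_eq_diskCount (f : ℤ[X]) :
    zerosInDisk f = diskCount (f.map (Int.castRingHom ℂ)) := rfl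

/-! ### Argument principle, homotopy invariance and Rouché's theorem. -/

theorem circleIntegral_inv_sub_of_one_lt_norm {a : ℂ} (ha : 1 < ‖a‖) :
    (∮ z in C(0, 1), (z - a)⁻¹) = 0 := by
  have hne : ∀ z ∈ Metric.closedBall (0 : ℂ) 1, z - a ≠ 0 := by
    intro z hz h
    rw [mem_closedBall_zero_iff, sub_eq_zero.1 h] at hz
    linarith
  refine Complex.circleIntegral_eq_zero_of_differentiable_on_off_countable zero_le_one
    Set.countable_empty ?_ ?_
  · exact (continuousOn_id.sub continuousOn_const).inv₀ hne
  · intro z hz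
    have := hne z (Metric.ball_subset_closedBall hz.1)
    fun_prop (disch := assumption)

theorem circleIntegral_sum_inv_sub (s : Multiset ℂ) (hs : ∀ a ∈ s, ‖a‖ ≠ 1) :
    (∮ z in C(0, 1), (s.map fun a => (z - a)⁻¹).sum) =
      2 * Real.pi * Complex.I * (Multiset.card (s.filter fun a => ‖a‖ < 1) : ℂ) ∧
    CircleIntegrable (fun z => (s.map fun a => (z - a)⁻¹).sum) 0 1 := by
  induction s using Multiset.induction_on with
  | empty => simp [circleIntegral]
  | cons a s ih =>
    obtain ⟨ih1, ih2⟩ := ih fun b hb => hs b (Multiset.mem_cons_of_mem hb)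
    have ha := hs a (Multiset.mem_cons_self a s)
    have hi : CircleIntegrable (fun z => (z - a)⁻¹) 0 1 := by
      rw [circleIntegrable_sub_inv_iff]
      right
      simpa using ha
    simp only [Multiset.map_cons, Multiset.sum_cons]
    refine ⟨?_, hi.add ih2⟩
    rw [circleIntegral.integral_add hi ih2, ih1]
    rcases lt_or_gt_of_ne ha with h | h
    · rw [circleIntegral.integral_sub_inv_of_mem_ball (by simpa using h),
        Multiset.filter_cons_of_pos (p := fun a : ℂ => ‖a‖ < 1) _ h, Multiset.card_cons]
      push_cast
      ring
    · rw [circleIntegral_inv_sub_of_one_lt_norm h, Multiset.filter_cons_of_neg (p := fun a : ℂ => ‖a‖ < 1) _ (by linarith), zero_add]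

theorem circleIntegral_logDeriv_eq_diskCount {p : ℂ[X]} (hp : ∀ z : ℂ, ‖z‖ = 1 → p.eval z ≠ 0) :
    (∮ z in C(0, 1), p.derivative.eval z / p.eval z) =
      2 * Real.pi * Complex.I * (diskCount p : ℂ) := by
  have h := (circleIntegral_sum_inv_sub p.roots
    fun a ha h1 => hp a h1 (isRoot_of_mem_roots ha)).1
  rw [diskCount, ← h]
  refine circleIntegral.integral_congr zero_le_one fun z hz => ?_
  have hz' : p.eval z ≠ 0 := hp z (by simpa using hz)
  rw [(IsAlgClosed.splits p).eval_derivative_div_eval_of_ne_zero hz']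
  simp only [one_div]

/-- By the argument principle the count is a contour integral continuous in `t`; being an integer,
it is constant on the interval. -/
theorem diskCount_eq_of_homotopy {p q : ℂ[X]}
    (h : ∀ t ∈ Set.Icc (0 : ℝ) 1, ∀ z : ℂ, ‖z‖ = 1 → (p + C (t : ℂ) * q).eval z ≠ 0) :
    diskCount (p + q) = diskCount p := by
  let F : unitInterval → ℂ := fun t =>
    ∮ z in C(0, 1), (p + C ((t : ℝ) : ℂ) * q).derivative.eval z / (p + C ((t : ℝ) : ℂ) * q).eval z
  have hF : Continuous F := by
    refine intervalIntegral.continuous_parametric_intervalIntegral_of_continuous' ?_ 0 _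
    have hne : ∀ x : unitInterval × ℝ,
        p.eval (circleMap 0 1 x.2) + ((x.1 : ℝ) : ℂ) * q.eval (circleMap 0 1 x.2) ≠ 0 := by
      intro x
      simpa using h x.1 x.1.2 (circleMap 0 1 x.2) (by simp)
    simp only [derivative_add, derivative_mul, derivative_C, zero_mul, zero_add, eval_add, eval_mul,
      eval_C, smul_eq_mul, deriv_circleMap]
    refine Continuous.mul (by fun_prop) (Continuous.div (by fun_prop) (by fun_prop) hne)
  have hFN : ∀ t : unitInterval, F t =
      2 * Real.pi * Complex.I * (diskCount (p + C ((t : ℝ) : ℂ) * q) : ℂ) :=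
    fun t => circleIntegral_logDeriv_eq_diskCount (h t t.2)
  let N : unitInterval → ℤ := fun t => (diskCount (p + C ((t : ℝ) : ℂ) * q) : ℤ)
  have hN : Continuous N := by
    rw [(Int.isClosedEmbedding_coe_real).isInducing.continuous_iff]
    have : (((↑) : ℤ → ℝ) ∘ N) = fun t => (F t / (2 * Real.pi * Complex.I)).re := by
      funext t
      rw [hFN, mul_div_cancel_left₀ _ Complex.two_pi_I_ne_zero]
      simp [N]
    rw [this]
    fun_prop
  have := (PreconnectedSpace.constant (inferInstance) hN : N 1 = N 0)
  simpa [N] using this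

theorem diskCount_add_eq_of_norm_lt {p q : ℂ[X]}
    (h : ∀ z : ℂ, ‖z‖ = 1 → ‖q.eval z‖ < ‖p.eval z‖) : diskCount (p + q) = diskCount p := by
  refine diskCount_eq_of_homotopy fun t ht z hz h0 => ?_
  have h1 : p.eval z = -((t : ℂ) * q.eval z) := by
    simpa using eq_neg_of_add_eq_zero_left (by simpa using h0)
  have h2 := h z hz
  rw [h1, norm_neg, norm_mul, Complex.norm_real, Real.norm_of_nonneg ht.1] at h2
  nlinarith [ht.2, norm_nonneg (q.eval z)]

theorem diskCount_C_mul {c : ℂ} (hc : c ≠ 0) (p : ℂ[X]) : diskCount (C c * p) = diskCount p := by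
  rw [diskCount, roots_C_mul p hc, diskCount]

theorem diskCount_X_mul {p : ℂ[X]} (hp : p ≠ 0) : diskCount (X * p) = diskCount p + 1 := by
  rw [diskCount, roots_mul (mul_ne_zero X_ne_zero hp), roots_X, Multiset.singleton_add,
    Multiset.filter_cons_of_pos _ (by simp), Multiset.card_cons, diskCount]

/-! ### Zeros of the reversed polynomial. -/

theorem roots_reverse_prod_X_sub_C (s : Multiset ℂ) (hs : (0 : ℂ) ∉ s) :
    (s.map fun a => X - C a).prod.reverse.roots = s.map (·⁻¹) := by
  induction s using Multiset.induction_on with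
  | empty => rw [Multiset.map_zero, Multiset.prod_zero, ← C_1, reverse_C]; simp
  | cons a s ih =>
    have ha : a ≠ 0 := fun h => hs (h ▸ Multiset.mem_cons_self a s)
    have h1 : (X - C a : ℂ[X]).reverse = C (-a) * (X - C a⁻¹) := by
      rw [reverse, natDegree_X_sub_C, reflect_sub, reflect_C, ← pow_one (X : ℂ[X]), reflect_monomial,
        revAt_le le_rfl, mul_sub, ← C_mul]
      simp [ha]
      ring
    have hne : ((s.map fun a => X - C a).prod : ℂ[X]) ≠ 0 :=
      (monic_multiset_prod_of_monic _ _ fun a _ => monic_X_sub_C a).ne_zero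
    rw [Multiset.map_cons, Multiset.prod_cons, reverse_mul_of_domain, h1, roots_mul,
      roots_C_mul _ (neg_ne_zero.2 ha), roots_X_sub_C,
      ih fun h => hs (Multiset.mem_cons_of_mem h), Multiset.map_cons, Multiset.singleton_add]
    refine mul_ne_zero (mul_ne_zero (by simpa using ha) (X_sub_C_ne_zero _)) ?_
    simpa using hne

theorem diskCount_reverse_add {p : ℂ[X]} (h0 : p.coeff 0 ≠ 0)
    (hp : ∀ z : ℂ, ‖z‖ = 1 → p.eval z ≠ 0) :
    diskCount p.reverse + diskCount p = p.natDegree := by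
  have hp0 : p ≠ 0 := by rintro rfl; simp at h0
  have hsp := IsAlgClosed.splits p
  have hz : (0 : ℂ) ∉ p.roots := by
    rw [mem_roots hp0, IsRoot, ← coeff_zero_eq_eval_zero]
    exact h0
  have hr : p.reverse.roots = p.roots.map (·⁻¹) := by
    conv_lhs => rw [hsp.eq_prod_roots]
    rw [reverse_mul_of_domain, reverse_C, roots_C_mul _ (leadingCoeff_ne_zero.2 hp0),
      roots_reverse_prod_X_sub_C _ hz]
  rw [diskCount, hr, diskCount, Multiset.filter_map, Multiset.card_map, hsp.natDegree_eq_card_roots,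
    ← Multiset.card_add]
  congr 1
  conv_rhs => rw [← Multiset.filter_add_not (fun z : ℂ => ‖z‖ < 1) p.roots]
  rw [add_comm]
  congr 1
  refine Multiset.filter_congr fun a ha => ?_
  have ha0 : 0 < ‖a‖ := norm_pos_iff.2 fun h => hz (h ▸ ha)
  have ha1 : ‖a‖ ≠ 1 := fun h => hp a h (isRoot_of_mem_roots ha)
  simp only [Function.comp, norm_inv, not_lt]
  rw [inv_lt_one₀ ha0]
  exact ⟨le_of_lt, fun h => lt_of_le_of_ne h ha1.symm⟩

/-! ### Coefficient lists and the Schur–Cohn recursion. -/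

/-- The integer polynomial with a given list of coefficients, lowest degree first. -/
noncomputable def ofCoeffs : List ℤ → ℤ[X]
  | [] => 0
  | a :: l => C a + X * ofCoeffs l

theorem aeval_ofCoeffs_cons (a : ℤ) (l : List ℤ) (z : ℂ) :
    aeval z (ofCoeffs (a :: l)) = a + z * aeval z (ofCoeffs l) := by
  simp [ofCoeffs]

theorem ofCoeffs_append (l m : List ℤ) :
    ofCoeffs (l ++ m) = ofCoeffs l + X ^ l.length * ofCoeffs m := by
  induction l with
  | nil => simp [ofCoeffs]
  | cons a l ih => simp only [List.cons_append, ofCoeffs, ih, List.length_cons]; ring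

theorem ofCoeffs_map_mul (c : ℤ) (l : List ℤ) :
    ofCoeffs (l.map (c * ·)) = C c * ofCoeffs l := by
  induction l with
  | nil => simp [ofCoeffs]
  | cons a l ih => simp only [List.map_cons, ofCoeffs, ih, C_mul]; ring

theorem ofCoeffs_zipWith (a b : ℤ) :
    ∀ l m : List ℤ, l.length = m.length →
      ofCoeffs (List.zipWith (fun x y => a * x - b * y) l m) = C a * ofCoeffs l - C b * ofCoeffs m
  | [], [], _ => by simp [ofCoeffs]
  | x :: l, y :: m, h => by
    rw [List.zipWith_cons_cons, ofCoeffs, ofCoeffs_zipWith a b l m (by simpa using h), ofCoeffs,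
      ofCoeffs, C_sub, C_mul, C_mul]
    ring

/-- On the circle, conjugation is inversion. The factor `z` on the left avoids the exponent
`l.length - 1`. -/
theorem mul_aeval_ofCoeffs_reverse {z : ℂ} (hz : ‖z‖ = 1) (l : List ℤ) :
    z * aeval z (ofCoeffs l.reverse) =
      z ^ l.length * (starRingEnd ℂ) (aeval z (ofCoeffs l)) := by
  have hzz : z * (starRingEnd ℂ) z = 1 := by
    rw [Complex.mul_conj, Complex.normSq_eq_norm_sq, hz]; simp
  induction l with
  | nil => simp [ofCoeffs]
  | cons a l ih =>
    have h1 : aeval z (ofCoeffs [a]) = (a : ℂ) := by simp [ofCoeffs]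
    rw [List.reverse_cons, ofCoeffs_append, map_add, mul_add, ih, aeval_ofCoeffs_cons, map_mul, h1,
      List.length_reverse, List.length_cons]
    simp only [map_add, map_mul, map_pow, aeval_X, map_intCast]
    linear_combination -z ^ l.length * (starRingEnd ℂ) (aeval z (ofCoeffs l)) * hzz

theorem norm_aeval_ofCoeffs_reverse {z : ℂ} (hz : ‖z‖ = 1) (l : List ℤ) :
    ‖aeval z (ofCoeffs l.reverse)‖ = ‖aeval z (ofCoeffs l)‖ := by
  simpa [hz] using congrArg norm (mul_aeval_ofCoeffs_reverse hz l)

/-- `f` has no zeros on the unit circle and exactly `k` zeros in the open unit disk. -/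
def HasDiskCount (f : ℤ[X]) (k : ℕ) : Prop :=
  (∀ z : ℂ, ‖z‖ = 1 → aeval z f ≠ 0) ∧ zerosInDisk f = k

theorem HasDiskCount.ne_zero {f : ℤ[X]} {k : ℕ} (h : HasDiskCount f k) : f ≠ 0 := by
  rintro rfl
  exact h.1 1 (by simp) (by simp)

theorem eval_map_intCast (f : ℤ[X]) (z : ℂ) :
    (f.map (Int.castRingHom ℂ)).eval z = aeval z f := by
  rw [eval_map, aeval_def, algebraMap_int_eq]

theorem hasDiskCount_C {c : ℤ} (hc : c ≠ 0) : HasDiskCount (C c) 0 := by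
  refine ⟨fun z _ => by simpa using hc, ?_⟩
  simp [zerosInDisk]

theorem HasDiskCount.X_mul {f : ℤ[X]} {k : ℕ} (h : HasDiskCount f k) :
    HasDiskCount (X * f) (k + 1) := by
  refine ⟨fun z hz => ?_, ?_⟩
  · rw [map_mul, aeval_X]
    exact mul_ne_zero (norm_ne_zero_iff.1 (by simp [hz])) (h.1 z hz)
  · have h0 : f.map (Int.castRingHom ℂ) ≠ 0 :=
      (Polynomial.map_ne_zero_iff (RingHom.injective_int _)).2 h.ne_zero
    rw [zerosInDisk_eq_diskCount, Polynomial.map_mul, map_X, diskCount_X_mul h0,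
      ← zerosInDisk_eq_diskCount, h.2]

theorem hasDiskCount_C_mul {f : ℤ[X]} {k : ℕ} {c : ℤ} (hc : c ≠ 0) :
    HasDiskCount (C c * f) k ↔ HasDiskCount f k := by
  have hc' : (c : ℂ) ≠ 0 := by exact_mod_cast hc
  have h : zerosInDisk (C c * f) = zerosInDisk f := by
    rw [zerosInDisk_eq_diskCount, Polynomial.map_mul, map_C, eq_intCast, diskCount_C_mul hc',
      zerosInDisk_eq_diskCount]
  rw [HasDiskCount, HasDiskCount, h]
  simp [hc]

/-- If `|g| = |f|` on the unit circle and `|b| < |a|`, then `f` has as many zeros in the disk as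
`a f - b g`. -/
theorem HasDiskCount.of_sub {f g : ℤ[X]} {k : ℕ} {a b : ℤ} (hab : |b| < |a|)
    (hfg : ∀ z : ℂ, ‖z‖ = 1 → ‖aeval z g‖ = ‖aeval z f‖)
    (h : HasDiskCount (C a * f - C b * g) k) : HasDiskCount f k := by
  have ha : a ≠ 0 := by rintro rfl; simp at hab; exact absurd hab (not_lt.2 (abs_nonneg b))
  have hne : ∀ z : ℂ, ‖z‖ = 1 → aeval z f ≠ 0 := by
    intro z hz h0
    refine h.1 z hz ?_
    have : aeval z g = 0 := norm_eq_zero.1 (by rw [hfg z hz, h0, norm_zero])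
    simp [h0, this]
  rw [← hasDiskCount_C_mul ha]
  refine ⟨fun z hz => by simpa [ha] using hne z hz, ?_⟩
  rw [← h.2, zerosInDisk_eq_diskCount, zerosInDisk_eq_diskCount, Polynomial.map_sub,
    sub_eq_add_neg]
  refine (diskCount_add_eq_of_norm_lt fun z hz => ?_).symm
  rw [eval_neg, norm_neg, eval_map_intCast, eval_map_intCast, map_mul, map_mul, norm_mul, norm_mul,
    hfg z hz]
  have : (|b| : ℝ) < |a| := by exact_mod_cast hab
  simpa [Complex.norm_intCast] using mul_lt_mul_of_pos_right this (norm_pos_iff.2 (hne z hz))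

theorem ofCoeffs_replicate_zero_append (m : ℕ) (l : List ℤ) :
    ofCoeffs (List.replicate m 0 ++ l) = X ^ m * ofCoeffs l := by
  induction m with
  | zero => simp
  | succ m ih =>
    rw [List.replicate_succ, List.cons_append, ofCoeffs, ih, C_0]
    ring

theorem ofCoeffs_append_replicate_zero (m : ℕ) (l : List ℤ) :
    ofCoeffs (l ++ List.replicate m 0) = ofCoeffs l := by
  have h := ofCoeffs_replicate_zero_append m []
  rw [List.append_nil] at h
  simp [ofCoeffs_append, h, ofCoeffs]

/-- The Schur–Cohn recursion: for a coefficient list with end coefficients `a` and `b` of distinct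
absolute values, combine the list with its reverse so as to cancel one end, and divide by the
content. The result is the number of zeros in the open unit disk, when the recursion succeeds. -/
def schurCohn : ℕ → List ℤ → Option ℕ
  | 0, _ => none
  | n + 1, l =>
    let a := l.headD 0
    let b := l.getLastD 0
    if l = [a] then if a = 0 then none else some 0
    else if |b| < |a| then
      let h := List.zipWith (fun x y => a * x - b * y) l l.reverse
      let c : ℤ := h.foldl (fun d x => (Int.gcd d x : ℤ)) 0
      let g := h.dropLast.map (· / c)
      -- This test certifies both the cancelled end and the exact division, so neither has to be
      -- proved for general lists.
      if c ≠ 0 ∧ h = g.map (c * ·) ++ [0] then schurCohn n g else none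
    else if |a| < |b| then
      let h := List.zipWith (fun x y => b * x - a * y) l l.reverse
      let c : ℤ := h.foldl (fun d x => (Int.gcd d x : ℤ)) 0
      let g := h.tail.map (· / c)
      if c ≠ 0 ∧ h = 0 :: g.map (c * ·) then (schurCohn n g).map (· + 1) else none
    else none

theorem hasDiskCount_of_schurCohn (n : ℕ) (l : List ℤ) (k : ℕ) (h : schurCohn n l = some k) :
    HasDiskCount (ofCoeffs l) k := by
  induction n generalizing l k with
  | zero => simp [schurCohn] at h
  | succ n ih =>
    rw [schurCohn] at h
    dsimp only at h
    -- Soundness uses only the inequality between `|a|` and `|b|`, not that they are end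
    -- coefficients.
    generalize l.headD 0 = a at h
    generalize l.getLastD 0 = b at h
    have key : ∀ a b : ℤ, |b| < |a| → ∀ h : List ℤ,
        List.zipWith (fun x y => a * x - b * y) l l.reverse = h → HasDiskCount (ofCoeffs h) k →
        HasDiskCount (ofCoeffs l) k := by
      intro a b hab h hh hk
      rw [← hh, ofCoeffs_zipWith _ _ _ _ (by simp)] at hk
      exact hk.of_sub hab fun z hz => norm_aeval_ofCoeffs_reverse hz l
    split_ifs at h with h1 h2 h3 h4 h5 h6
    · rw [h1, ← Option.some_injective _ h]
      simpa [ofCoeffs] using hasDiskCount_C h2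
    · refine key a b h3 _ h4.2 ?_
      have h0 : ofCoeffs [0] = 0 := by simp [ofCoeffs]
      rw [ofCoeffs_append, h0, mul_zero, add_zero, ofCoeffs_map_mul]
      exact (hasDiskCount_C_mul h4.1).2 (ih _ _ h)
    · obtain ⟨j, hj, rfl⟩ := Option.map_eq_some_iff.1 h
      refine key b a h5 _ h6.2 ?_
      rw [ofCoeffs, C_0, zero_add, ofCoeffs_map_mul]
      exact ((hasDiskCount_C_mul h6.1).2 (ih _ _ hj)).X_mul

/-- Newman polynomials have end coefficients of equal absolute value, so the recursion is started
after multiplication by `X ^ m + 2`, which has no zeros in the closed disk. -/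
theorem hasDiskCount_of_schurCohn_mul (m n : ℕ) (l : List ℤ) (k : ℕ)
    (h : schurCohn n (List.zipWith (fun x y => 2 * x - -1 * y)
      (l ++ List.replicate m 0) (List.replicate m 0 ++ l)) = some k) :
    HasDiskCount (ofCoeffs l) k := by
  have := hasDiskCount_of_schurCohn n _ k h
  rw [ofCoeffs_zipWith _ _ _ _ (by simp [add_comm]), ofCoeffs_append_replicate_zero,
    ofCoeffs_replicate_zero_append] at this
  exact this.of_sub (by norm_num) fun z hz => by simp [hz]

/-! ### Explicit polynomials: starting members of the families, and degrees 7 and 15. -/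

theorem hasDiskCount_three : HasDiskCount (1 + X ^ 2 + X ^ 3) 2 := by
  have h := hasDiskCount_of_schurCohn_mul 1 10 [1, 0, 1, 1] 2 (by decide)
  convert h using 1
  simp [ofCoeffs]
  ring

theorem hasDiskCount_four : HasDiskCount (1 + X + X ^ 4) 2 := by
  have h := hasDiskCount_of_schurCohn_mul 1 10 [1, 1, 0, 0, 1] 2 (by decide)
  convert h using 1
  simp [ofCoeffs]
  ring

theorem hasDiskCount_five : HasDiskCount (1 + X + X ^ 2 + X ^ 4 + X ^ 5) 2 := by
  -- With the multiplier `X + 2` the recursion stops after one step, at a list with both ends equal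
  -- to 3; hence `X ^ 2 + 2`.
  have h := hasDiskCount_of_schurCohn_mul 2 10 [1, 1, 1, 0, 1, 1] 2 (by decide)
  convert h using 1
  simp [ofCoeffs]
  ring

theorem hasDiskCount_six : HasDiskCount (1 + X + X ^ 6) 2 := by
  have h := hasDiskCount_of_schurCohn_mul 1 10 [1, 1, 0, 0, 0, 0, 1] 2 (by decide)
  convert h using 1
  simp [ofCoeffs]
  ring

theorem hasDiskCount_seven : HasDiskCount (1 + X + X ^ 2 + X ^ 4 + X ^ 7) 2 := by
  have h := hasDiskCount_of_schurCohn_mul 1 20 [1, 1, 1, 0, 1, 0, 0, 1] 2 (by decide)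
  convert h using 1
  simp [ofCoeffs]
  ring

theorem hasDiskCount_fifteen :
    HasDiskCount (1 + X + X ^ 2 + X ^ 4 + X ^ 7 + X ^ 9 + X ^ 10 + X ^ 12 + X ^ 15) 2 := by
  have h := hasDiskCount_of_schurCohn_mul 1 20
    [1, 1, 1, 0, 1, 0, 0, 1, 0, 1, 1, 0, 1, 0, 0, 1] 2 (by decide)
  convert h using 1
  simp [ofCoeffs]
  ring

/-! ### Convex combinations of self-reciprocal geometric sums -/

/-- If the expression vanishes, `B * G = -1` is real, and the symmetry of `B` forces `conj G = w *
G`. As `G * (w - 1) = u - 1` with `u` a convex combination of `w ^ k` and `w ^ l`, this gives `Re u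
= 1`. But `‖u‖ ≤ 1`, so `u = 1` and `G = 0`, which is absurd. -/
theorem one_add_mul_geom_sum_ne_zero {w B : ℂ} (hw : ‖w‖ = 1) (hw1 : w ≠ 1)
    (hB : w * (starRingEnd ℂ) B = B) {t : ℝ} (ht : t ∈ Set.Icc (0 : ℝ) 1) (k l : ℕ) :
    1 + B * ((1 - t) * ∑ i ∈ Finset.range k, w ^ i + t * ∑ i ∈ Finset.range l, w ^ i) ≠ 0 := by
  set G : ℂ := (1 - t) * ∑ i ∈ Finset.range k, w ^ i + t * ∑ i ∈ Finset.range l, w ^ i with hG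
  set u : ℂ := (1 - t) * w ^ k + t * w ^ l with hu
  intro h
  have hww : w * (starRingEnd ℂ) w = 1 := by
    rw [Complex.mul_conj, Complex.normSq_eq_norm_sq, hw]; simp
  have hGu : G * (w - 1) = u - 1 := by
    rw [hG, hu, add_mul, mul_assoc, mul_assoc, geom_sum_mul, geom_sum_mul]
    ring
  have hB0 : B ≠ 0 := by rintro rfl; simp at h
  have hw0 : w ≠ 0 := by rintro rfl; simp at hw
  have hconj : 1 + (starRingEnd ℂ) B * (starRingEnd ℂ) G = 0 := by
    simpa using congrArg (starRingEnd ℂ) h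
  have hGG : (starRingEnd ℂ) G = w * G := by
    refine mul_left_cancel₀ hB0 ?_
    linear_combination w * hconj - w * h - (starRingEnd ℂ) G * hB
  have hGu' : (starRingEnd ℂ) G * ((starRingEnd ℂ) w - 1) = (starRingEnd ℂ) u - 1 := by
    simpa using congrArg (starRingEnd ℂ) hGu
  have hre : u + (starRingEnd ℂ) u = 2 := by
    rw [hGG] at hGu'
    linear_combination -hGu - hGu' + G * hww
  have hre1 : u.re = 1 := by
    have := congrArg Complex.re hre
    simp at this
    linarith
  have hnorm : ‖u‖ ≤ 1 := by
    calc ‖u‖ ≤ ‖(1 - t : ℂ) * w ^ k‖ + ‖(t : ℂ) * w ^ l‖ := norm_add_le _ _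
      _ = (1 - t) + t := by
        rw [norm_mul, norm_mul, norm_pow, norm_pow, hw, one_pow, one_pow, mul_one, mul_one,
          Complex.norm_real, Real.norm_of_nonneg ht.1, ← Complex.ofReal_one, ← Complex.ofReal_sub,
          Complex.norm_real, Real.norm_of_nonneg (by linarith [ht.2])]
      _ = 1 := by ring
  have hu1 : u = 1 := by
    have h1 : ‖u‖ ^ 2 ≤ 1 := by nlinarith [norm_nonneg u]
    rw [← Complex.normSq_eq_norm_sq, Complex.normSq_apply, hre1] at h1
    have him : u.im = 0 := by nlinarith [sq_nonneg u.im]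
    exact Complex.ext (by simpa using hre1) (by simpa using him)
  have hG0 : G = 0 := by
    rw [hu1, sub_self] at hGu
    exact (mul_eq_zero.1 hGu).resolve_right (sub_ne_zero.2 hw1)
  simp [hG0] at h

/-- Where `z ^ d = 1` the interpolated geometric sum is a real number `s` between `k₀` and `k`, a
case left to `hroot`. The factor `z ^ a` allows `B` to contain negative powers of `z`. -/
theorem hasDiskCount_of_geom_sum {f : ℕ → ℤ[X]} {a d k₀ m : ℕ} {B : ℂ → ℂ}
    (hf : ∀ k, k₀ ≤ k → ∀ z : ℂ, ‖z‖ = 1 →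
      aeval z (f k) = z ^ a * (1 + B z * ∑ i ∈ Finset.range k, (z ^ d) ^ i))
    (hB : ∀ z : ℂ, ‖z‖ = 1 → z ^ d * (starRingEnd ℂ) (B z) = B z)
    (hroot : ∀ z : ℂ, ‖z‖ = 1 → z ^ d = 1 → ∀ s : ℝ, (k₀ : ℝ) ≤ s → 1 + B z * s ≠ 0)
    (h0 : HasDiskCount (f k₀) m) {k : ℕ} (hk : k₀ ≤ k) : HasDiskCount (f k) m := by
  have key : ∀ t ∈ Set.Icc (0 : ℝ) 1, ∀ z : ℂ, ‖z‖ = 1 →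
      aeval z (f k₀) + (t : ℂ) * (aeval z (f k) - aeval z (f k₀)) ≠ 0 := by
    intro t ht z hz
    have hz0 : z ≠ 0 := by rintro rfl; simp at hz
    have h : aeval z (f k₀) + (t : ℂ) * (aeval z (f k) - aeval z (f k₀)) =
        z ^ a * (1 + B z * ((1 - t) * ∑ i ∈ Finset.range k₀, (z ^ d) ^ i +
          t * ∑ i ∈ Finset.range k, (z ^ d) ^ i)) := by
      rw [hf k hk z hz, hf k₀ le_rfl z hz]
      ring
    rw [h]
    refine mul_ne_zero (pow_ne_zero _ hz0) ?_
    by_cases hw : z ^ d = 1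
    · have hkk : (k₀ : ℝ) ≤ k := by exact_mod_cast hk
      have := hroot z hz hw ((1 - t) * k₀ + t * k) (by nlinarith [ht.1])
      simpa [hw] using this
    · exact one_add_mul_geom_sum_ne_zero (by simp [hz]) hw (hB z hz) ht k₀ k
  refine ⟨fun z hz => by simpa using key 1 (by simp) z hz, ?_⟩
  rw [← h0.2, zerosInDisk_eq_diskCount, zerosInDisk_eq_diskCount]
  have := diskCount_eq_of_homotopy (p := (f k₀).map (Int.castRingHom ℂ))
    (q := (f k).map (Int.castRingHom ℂ) - (f k₀).map (Int.castRingHom ℂ))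
    fun t ht z hz => by
      simpa only [eval_add, eval_mul, eval_C, eval_sub, eval_map_intCast] using key t ht z hz
  rwa [add_sub_cancel] at this

/-! ### Building Newman polynomials term by term -/

/-- Polynomials with coefficients in `{0, 1}`, constant term `1` and degree less than `m`. -/
def IsNewmanBelow (m : ℕ) (f : ℤ[X]) : Prop :=
  0 < m ∧ f.coeff 0 = 1 ∧ (∀ j, f.coeff j = 0 ∨ f.coeff j = 1) ∧ ∀ j, m ≤ j → f.coeff j = 0

theorem isNewmanBelow_one : IsNewmanBelow 1 1 := by
  refine ⟨one_pos, by simp, fun j => ?_, fun j hj => ?_⟩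
  · rw [coeff_one]; split_ifs <;> simp
  · rw [coeff_one, if_neg (by omega)]

theorem IsNewmanBelow.mono {m n : ℕ} {f : ℤ[X]} (h : IsNewmanBelow m f) (hmn : m ≤ n) :
    IsNewmanBelow n f :=
  ⟨h.1.trans_le hmn, h.2.1, h.2.2.1, fun j hj => h.2.2.2 j (hmn.trans hj)⟩

theorem IsNewmanBelow.add_X_pow {m n : ℕ} {f : ℤ[X]} (h : IsNewmanBelow m f) (hmn : m ≤ n) :
    IsNewmanBelow (n + 1) (f + X ^ n) := by
  obtain ⟨hm, h0, h1, h2⟩ := h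
  refine ⟨n.succ_pos, ?_, fun j => ?_, fun j hj => ?_⟩
  · rw [coeff_add, h0, coeff_X_pow, if_neg (by omega), add_zero]
  · rw [coeff_add, coeff_X_pow]
    split_ifs with hj
    · simp [h2 j (by omega)]
    · simpa using h1 j
  · rw [coeff_add, h2 j (by omega), coeff_X_pow, if_neg (by omega), add_zero]

theorem IsNewmanBelow.add_X_pow_mem {m n : ℕ} {f : ℤ[X]} (h : IsNewmanBelow m f) (hmn : m ≤ n) :
    f + X ^ n ∈ newmanPolys n := by
  obtain ⟨-, h0, h1, h2⟩ := h.add_X_pow hmn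
  have hn : (f + X ^ n).coeff n = 1 := by
    rw [coeff_add, h.2.2.2 n hmn, coeff_X_pow_self, zero_add]
  refine ⟨natDegree_eq_of_le_of_coeff_ne_zero ?_ (by simp [hn]), h0, hn, h1⟩
  exact natDegree_le_iff_coeff_eq_zero.2 fun j hj => h2 j (by omega)

theorem reverse_mem_newmanPolys {n : ℕ} {f : ℤ[X]} (hf : f ∈ newmanPolys n) :
    f.reverse ∈ newmanPolys n := by
  obtain ⟨rfl, h0, hn, h1⟩ := hf
  have htr : f.natTrailingDegree = 0 := natTrailingDegree_eq_zero.2 (Or.inr (by simp [h0]))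
  refine ⟨by rw [reverse_natDegree, htr, Nat.sub_zero], ?_, ?_, fun j => ?_⟩
  · rw [coeff_zero_reverse]; exact hn
  · rw [coeff_reverse, revAt_le le_rfl, Nat.sub_self, h0]
  · rw [coeff_reverse]; exact h1 _

theorem HasDiskCount.reverse {f : ℤ[X]} {k : ℕ} (h : HasDiskCount f k) (h0 : f.coeff 0 ≠ 0) :
    HasDiskCount f.reverse (f.natDegree - k) := by
  have hinj : Function.Injective (Int.castRingHom ℂ) := RingHom.injective_int _
  have hmap : f.reverse.map (Int.castRingHom ℂ) = (f.map (Int.castRingHom ℂ)).reverse := by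
    ext j
    rw [coeff_map, coeff_reverse, coeff_reverse, coeff_map, natDegree_map_eq_of_injective hinj]
  constructor
  · intro z hz
    have hz0 : z ≠ 0 := by rintro rfl; simp at hz
    let _ : Invertible z⁻¹ := invertibleOfNonzero (inv_ne_zero hz0)
    have := eval₂_reverse_eq_zero_iff (algebraMap ℤ ℂ) z⁻¹ f
    rw [invOf_eq_inv, inv_inv] at this
    rw [aeval_def, Ne, this, ← aeval_def]
    exact h.1 _ (by simp [hz])
  · have := diskCount_reverse_add (p := f.map (Int.castRingHom ℂ)) (by simpa using h0)
      fun z hz => by rw [eval_map_intCast]; exact h.1 z hz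
    rw [natDegree_map_eq_of_injective hinj, ← hmap, ← zerosInDisk_eq_diskCount,
      ← zerosInDisk_eq_diskCount, h.2] at this
    omega

theorem newmanAdmissible_of_hasDiskCount {n k : ℕ} {f : ℤ[X]} (hf : f ∈ newmanPolys n)
    (h : HasDiskCount f k) (hk : 1 ≤ k) (hkn : k < n) :
    NewmanAdmissible k n ∧ NewmanAdmissible (n - k) n := by
  have hr := h.reverse (by simp [hf.2.1])
  rw [hf.1] at hr
  exact ⟨⟨⟨hk, hkn⟩, f, hf, h⟩, ⟨by omega, by omega⟩, f.reverse, reverse_mem_newmanPolys hf, hr⟩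

/-! ### The periodic families -/

/-- The Newman polynomial `1 + (X ^ a + X ^ b) (1 + X ^ d + ⋯ + X ^ (d (k - 1)))` with period
`d = a + b`. -/
noncomputable def periodicNewman (a b k : ℕ) : ℤ[X] :=
  1 + ∑ i ∈ Finset.range k, (X ^ ((a + b) * i + a) + X ^ ((a + b) * i + b))

theorem periodicNewman_succ (a b k : ℕ) : periodicNewman a b (k + 1) =
    periodicNewman a b k + X ^ ((a + b) * k + a) + X ^ ((a + b) * k + b) := by
  rw [periodicNewman, Finset.sum_range_succ, periodicNewman]
  ring

theorem isNewmanBelow_periodicNewman {a b : ℕ} (ha : 0 < a) (hab : a < b) (k : ℕ) :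
    IsNewmanBelow ((a + b) * k + 1) (periodicNewman a b k) := by
  induction k with
  | zero => simpa [periodicNewman] using isNewmanBelow_one
  | succ k ih =>
    rw [periodicNewman_succ]
    exact ((ih.add_X_pow (by omega)).add_X_pow (by omega)).mono (by rw [mul_add]; omega)

theorem periodicNewman_succ_mem {a b : ℕ} (ha : 0 < a) (hab : a < b) (k : ℕ) :
    periodicNewman a b (k + 1) ∈ newmanPolys ((a + b) * k + b) := by
  rw [periodicNewman_succ]
  exact ((isNewmanBelow_periodicNewman ha hab k).add_X_pow (by omega)).add_X_pow_mem (by omega)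

theorem hasDiskCount_periodicNewman {a b k₀ m : ℕ}
    (hroot : ∀ z : ℂ, z ^ (a + b) = 1 → ∀ s : ℝ, (k₀ : ℝ) ≤ s → 1 + (z ^ a + z ^ b) * s ≠ 0)
    (h0 : HasDiskCount (periodicNewman a b k₀) m) {k : ℕ} (hk : k₀ ≤ k) :
    HasDiskCount (periodicNewman a b k) m := by
  refine hasDiskCount_of_geom_sum (a := 0) (d := a + b) (B := fun z => z ^ a + z ^ b) ?_ ?_
    (fun z _ => hroot z) h0 hk
  · intro k _ z _
    simp only [periodicNewman, map_add, map_one, map_sum, map_pow, aeval_X, pow_zero, one_mul,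
      Finset.mul_sum]
    congr 1
    refine Finset.sum_congr rfl fun i _ => ?_
    rw [← pow_mul]
    ring
  · intro z hz
    have hzz : z * (starRingEnd ℂ) z = 1 := by
      rw [Complex.mul_conj, Complex.normSq_eq_norm_sq, hz]; simp
    have h : ∀ j : ℕ, z ^ j * (starRingEnd ℂ) z ^ j = 1 := fun j => by
      rw [← mul_pow, hzz, one_pow]
    simp only [map_add, map_pow, pow_add]
    linear_combination z ^ b * h a + z ^ a * h b

/-- The Newman polynomial `1 + X + X ^ 4 + X ^ 6 + ⋯ + X ^ (2 k - 2) + X ^ (2 k + 2)`. -/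
noncomputable def evenNewman (k : ℕ) : ℤ[X] :=
  1 + X + ∑ i ∈ Finset.range (k - 2), X ^ (2 * i + 4) + X ^ (2 * k + 2)

theorem evenNewman_mem {k : ℕ} (hk : 2 ≤ k) : evenNewman k ∈ newmanPolys (2 * k + 2) := by
  have h : ∀ m : ℕ, IsNewmanBelow (2 * m + 4)
      (1 + X + ∑ i ∈ Finset.range m, X ^ (2 * i + 4) : ℤ[X]) := by
    intro m
    induction m with
    | zero => simpa using (isNewmanBelow_one.add_X_pow le_rfl).mono (by norm_num)
    | succ m ih =>
      rw [Finset.sum_range_succ, ← add_assoc]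
      exact (ih.add_X_pow le_rfl).mono (by omega)
  exact (h (k - 2)).add_X_pow_mem (by omega)

theorem hasDiskCount_evenNewman {k : ℕ} (hk : 2 ≤ k) : HasDiskCount (evenNewman k) 2 := by
  refine hasDiskCount_of_geom_sum (a := 1) (d := 2)
    (B := fun z => (starRingEnd ℂ) z * (1 - z ^ 2 + z ^ 4)) ?_ ?_ ?_
    (by simpa [evenNewman] using hasDiskCount_six) hk
  · intro k hk z hz
    have hzz : z * (starRingEnd ℂ) z = 1 := by
      rw [Complex.mul_conj, Complex.normSq_eq_norm_sq, hz]; simp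
    obtain ⟨m, rfl⟩ := Nat.exists_eq_add_of_le' hk
    -- Multiplying the geometric sum by this factor deletes the terms of exponent 2 and `2 * (m +
    -- 2)`, and appends the top one.
    have h : (1 - z ^ 2 + z ^ 4) * ∑ i ∈ Finset.range (m + 2), (z ^ 2) ^ i =
        1 + ∑ i ∈ Finset.range m, z ^ (2 * i + 4) + z ^ (2 * (m + 2) + 2) := by
      induction m with
      | zero => simp [Finset.sum_range_succ]; ring
      | succ m ih =>
        rw [add_right_comm, Finset.sum_range_succ, mul_add, ih (by omega), Finset.sum_range_succ]
        ring
    simp only [evenNewman, map_add, map_one, map_sum, map_pow, aeval_X, Nat.add_sub_cancel]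
    linear_combination -h - (1 - z ^ 2 + z ^ 4) * (∑ i ∈ Finset.range (m + 2), (z ^ 2) ^ i) * hzz
  · intro z hz
    have hzz : z * (starRingEnd ℂ) z = 1 := by
      rw [Complex.mul_conj, Complex.normSq_eq_norm_sq, hz]; simp
    simp only [map_add, map_sub, map_mul, map_pow, map_one, Complex.conj_conj]
    have h : ∀ j : ℕ, z ^ j * (starRingEnd ℂ) z ^ j = 1 := fun j => by
      rw [← mul_pow, hzz, one_pow]
    linear_combination (z ^ 2 * (starRingEnd ℂ) z ^ 3 - z ^ 3 + z) * hzz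
      + ((starRingEnd ℂ) z - z) * h 2
  · intro z hz h2 s hs h
    have hs' : (2 : ℝ) ≤ s := by exact_mod_cast hs
    -- Here `z = ±1` and `B z = z`, so the values to exclude are `1 + s` and `1 - s`.
    rcases sq_eq_sq_iff_eq_or_eq_neg.1 (h2.trans (one_pow 2).symm) with rfl | rfl
    · have : 1 + s = 0 := by
        rw [← Complex.ofReal_inj]; push_cast; simpa using h
      linarith
    · have : 1 - s = 0 := by
        rw [← Complex.ofReal_inj]; push_cast
        simp only [map_neg, map_one] at h
        linear_combination h
      linarith

theorem hasDiskCount_periodicNewman_one_two {k : ℕ} (hk : 2 ≤ k) :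
    HasDiskCount (periodicNewman 1 2 k) 2 := by
  -- The family cannot start at 1: `1 + X + X ^ 2` vanishes at the primitive cube roots of unity.
  refine hasDiskCount_periodicNewman (k₀ := 2) ?_ ?_ hk
  · intro z hz s hs h
    have hs' : (2 : ℝ) ≤ s := by exact_mod_cast hs
    have hfac : (z - 1) * (1 + z + z ^ 2) = 0 := by linear_combination hz
    rcases mul_eq_zero.1 hfac with h1 | h1
    · rw [sub_eq_zero.1 h1] at h
      have : 1 + 2 * s = 0 := by
        rw [← Complex.ofReal_inj]; push_cast; linear_combination h
      linarith
    · have : 1 - s = 0 := by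
        rw [← Complex.ofReal_inj]; push_cast; linear_combination h - s * h1
      linarith
  · convert hasDiskCount_five using 1
    simp [periodicNewman, Finset.sum_range_succ]
    ring

/-- For a fifth root of unity `z`, both `z ^ 2 + z ^ 3` and `z + z ^ 4` are such a `b`: 2 at `z =
1`, otherwise a root of the quadratic. In the latter case a zero would need `s ^ 2 + s = 1`,
impossible for `s ≥ 1`. -/
theorem one_add_mul_ne_zero_of_sq_add_self {b : ℂ} (hb : b = 2 ∨ b ^ 2 + b - 1 = 0) {s : ℝ}
    (hs : 1 ≤ s) : 1 + b * s ≠ 0 := by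
  intro h
  rcases hb with rfl | hb
  · have : 1 + 2 * s = 0 := by
      rw [← Complex.ofReal_inj]; push_cast; exact h
    linarith
  · have : 1 - s - s ^ 2 = 0 := by
      rw [← Complex.ofReal_inj]; push_cast
      linear_combination s ^ 2 * hb + (1 - s - b * s) * h
    nlinarith

theorem hasDiskCount_periodicNewman_two_three {k : ℕ} (hk : 1 ≤ k) :
    HasDiskCount (periodicNewman 2 3 k) 2 := by
  refine hasDiskCount_periodicNewman (k₀ := 1) ?_ ?_ hk
  · intro z hz s hs
    refine one_add_mul_ne_zero_of_sq_add_self ?_ (by exact_mod_cast hs)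
    have hfac : (z - 1) * (1 + z + z ^ 2 + z ^ 3 + z ^ 4) = 0 := by linear_combination hz
    rcases mul_eq_zero.1 hfac with h1 | h1
    · left; rw [sub_eq_zero.1 h1]; norm_num
    · right; linear_combination h1 + (z + 2) * hz
  · convert hasDiskCount_three using 1
    simp [periodicNewman]
    ring

theorem hasDiskCount_periodicNewman_one_four {k : ℕ} (hk : 1 ≤ k) :
    HasDiskCount (periodicNewman 1 4 k) 2 := by
  refine hasDiskCount_periodicNewman (k₀ := 1) ?_ ?_ hk
  · intro z hz s hs
    refine one_add_mul_ne_zero_of_sq_add_self ?_ (by exact_mod_cast hs)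
    have hfac : (z - 1) * (1 + z + z ^ 2 + z ^ 3 + z ^ 4) = 0 := by linear_combination hz
    rcases mul_eq_zero.1 hfac with h1 | h1
    · left; rw [sub_eq_zero.1 h1]; norm_num
    · right; linear_combination h1 + (z ^ 3 + 2) * hz
  · convert hasDiskCount_four using 1
    simp [periodicNewman]
    ring

/-! ### Covering the degrees by residues modulo 30. -/

theorem theorem2p3 (n : ℕ)
    (hn : (3 ≤ n ∧ n ≤ 20) ∨
      (20 < n ∧ ∀ r ∈ ({1, 7, 15, 21, 25, 27} : Finset ℕ), ¬ n ≡ r [MOD 30])) :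
    NewmanAdmissible 2 n ∧ NewmanAdmissible (n - 2) n := by
  suffices h : ∃ f ∈ newmanPolys n, HasDiskCount f 2 by
    obtain ⟨f, hf, h⟩ := h
    exact newmanAdmissible_of_hasDiskCount hf h one_le_two (by omega)
  have hcases : (∃ k, 2 ≤ k ∧ n = 2 * k + 2) ∨ (∃ k, 1 ≤ k ∧ n = 3 * k + 2) ∨
      (∃ k, n = 5 * k + 3) ∨ (∃ k, n = 5 * k + 4) ∨ n = 7 ∨ n = 15 := by
    -- The six excluded residues are exactly those that are odd, not 2 mod 3, and neither 3 nor 4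
    -- mod 5; between 3 and 20 only 7 and 15 have such residues.
    have h : (n % 2 = 0 ∧ 6 ≤ n) ∨ (n % 3 = 2 ∧ 5 ≤ n) ∨ n % 5 = 3 ∨ n % 5 = 4 ∨ n = 7 ∨ n = 15 := by
      simp only [Finset.mem_insert, Finset.mem_singleton, forall_eq_or_imp, forall_eq,
        Nat.ModEq] at hn
      rcases hn with ⟨h3, h20⟩ | ⟨h20, hn⟩
      · interval_cases n <;> simp
      · have h2 : n % 2 = n % 30 % 2 := by omega
        have h3 : n % 3 = n % 30 % 3 := by omega
        have h5 : n % 5 = n % 30 % 5 := by omega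
        have h30 : n % 30 < 30 := Nat.mod_lt _ (by norm_num)
        rw [h2, h3, h5]
        generalize n % 30 = r at *
        interval_cases r <;> omega
    rcases h with h | h | h | h | h | h
    · exact Or.inl ⟨n / 2 - 1, by omega, by omega⟩
    · exact Or.inr (Or.inl ⟨n / 3, by omega, by omega⟩)
    · exact Or.inr (Or.inr (Or.inl ⟨n / 5, by omega⟩))
    · exact Or.inr (Or.inr (Or.inr (Or.inl ⟨n / 5, by omega⟩)))
    · simp [h]
    · simp [h]
  rcases hcases with ⟨k, hk, rfl⟩ | ⟨k, hk, rfl⟩ | ⟨k, rfl⟩ | ⟨k, rfl⟩ | rfl | rfl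
  · exact ⟨_, evenNewman_mem hk, hasDiskCount_evenNewman hk⟩
  · exact ⟨_, periodicNewman_succ_mem one_pos one_lt_two k,
      hasDiskCount_periodicNewman_one_two (by omega)⟩
  · exact ⟨_, periodicNewman_succ_mem two_pos (by norm_num) k,
      hasDiskCount_periodicNewman_two_three (by omega)⟩
  · exact ⟨_, periodicNewman_succ_mem one_pos (by norm_num) k,
      hasDiskCount_periodicNewman_one_four (by omega)⟩
  · refine ⟨_, ?_, hasDiskCount_seven⟩
    have h := (isNewmanBelow_one.add_X_pow (n := 1) le_rfl).add_X_pow (n := 2) le_rfl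
    simpa using (h.add_X_pow (n := 4) (by norm_num)).add_X_pow_mem (n := 7) (by norm_num)
  · refine ⟨_, ?_, hasDiskCount_fifteen⟩
    have h := (isNewmanBelow_one.add_X_pow (n := 1) le_rfl).add_X_pow (n := 2) le_rfl
    have h := (h.add_X_pow (n := 4) (by norm_num)).add_X_pow (n := 7) (by norm_num)
    have h := (h.add_X_pow (n := 9) (by norm_num)).add_X_pow (n := 10) (by norm_num)
    simpa using (h.add_X_pow (n := 12) (by norm_num)).add_X_pow_mem (n := 15) (by norm_num)
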